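/- Let $\mathbb{D}=\{z\in\mathbb{C}:|z|<1\}$. For functions $f,g$ on $\mathbb{D}$ write $f\prec g$ ($f$ is subordinate to $g$) if there is an analytic function $w$ on $\mathbb{D}$ with $w(0)=0$ and $|w(z)|<1$ for all $z\in\mathbb{D}$ such that $f(z)=g(w(z))$ for all $z\in\mathbb{D}$. Put $$\varphi_c(z)=1+\frac{4z}{3}+\frac{2z^2}{3},\qquad \varphi_{SG}(z)=\frac{2}{1+e^{-z}}.$$ Let $\beta$ be a real number. Then the following hold for all functions $p$ analytic in $\mathbb{D}$ with $p(0)=1$. (a) If $\beta\ge \dfrac{5(e+1)}{3(e-1)}$ and $1+\beta z p'(z)\prec\varphi_c(z)$, then $p\prec\varphi_{SG}$. (b) If $\beta\ge \dfrac{5}{3(1+\log 2-\log(1+e))}$ and $1+\beta\,\dfrac{zp'(z)}{p(z)}\prec\varphi_c(z)$, then $p\prec\varphi_{SG}$. (c) If $\beta\ge \dfrac{10e}{3(e-1)}$ and $1+\beta\,\dfrac{zp'(z)}{p(z)^2}\prec\varphi_c(z)$, then $p\prec\varphi_{SG}$. The bounds on $\beta$ are sharp: in each of the three cases, for every $\beta$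 with $0<\beta<\beta_0$, where $\beta_0$ is the bound of that case, there is a function $p$ analytic in $\mathbb{D}$ with $p(0)=1$ that satisfies the subordination to $\varphi_c$ assumed in that case but for which $p\prec\varphi_{SG}$ fails. -/

import Mathlib

/-- The open unit disc of the complex plane. -/
def unitDisk : Set ℂ := Metric.ball 0 1

/-- Subordination `f ≺ g` on the open unit disc: `f = g ∘ w` on the disc for some analytic `w`
from the disc to itself with `w 0 = 0`. -/
def Subordinate (f g : ℂ → ℂ) : Prop :=
  ∃ w : ℂ → ℂ, AnalyticOnNhd ℂ w unitDisk ∧ w 0 = 0 ∧ (∀ z ∈ unitDisk, ‖w z‖ < 1) ∧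
    ∀ z ∈ unitDisk, f z = g (w z)

/-- The function `φ_c(z) = 1 + 4z/3 + 2z²/3`. -/
noncomputable def phiC (z : ℂ) : ℂ := 1 + 4 * z / 3 + 2 * z ^ 2 / 3

/-- The function `φ_SG(z) = 2 / (1 + e^{-z})`; the denominator has no zero in the unit disc. -/
noncomputable def phiSG (z : ℂ) : ℂ := 2 / (1 + Complex.exp (-z))

/-- The expression `1 + β z p'(z) / p(z)^j`. If `p` is analytic with a zero in the disc and
`p 0 = 1`, then for `j ≥ 1` and `β ≠ 0` this expression is unbounded near that zero, so it is not subordinate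
to a function that is bounded on the disc; the value of the quotient at a zero of `p` therefore
plays no role below. -/
noncomputable def diffExpr (j : ℕ) (β : ℝ) (p : ℂ → ℂ) (z : ℂ) : ℂ :=
  1 + (β : ℂ) * (z * deriv p z / p z ^ j)

/-- For every analytic `p` on the unit disc with `p 0 = 1`, the subordination
`1 + β z p'(z) / p(z)^j ≺ φ_c(z)` implies `p ≺ φ_SG`. -/
def SubordinationImplies (j : ℕ) (β : ℝ) : Prop :=
  ∀ p : ℂ → ℂ, AnalyticOnNhd ℂ p unitDisk → p 0 = 1 →
    Subordinate (diffExpr j β p) phiC → Subordinate p phiSG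

/-! By the Schwarz lemma the subordinating map is `z * k z` with `‖k z‖ ≤ 1`. The hypothesis becomes
`p' = F' p ^ j` with `F 0 = 0` and `‖F'‖ ≤ (4 + 2‖z‖) / (3β)`, hence `‖F‖ < 5 / (3β)`. Solving the
equation gives `p = 1 + F`, `exp F` or `1 / (1 - F)` for `j = 0, 1, 2`. Inverting `φ_SG` gives `w =
log (p / (2 - p))`, that is `log (1 + F) - log (1 - F)`, `F - log (2 - exp F)` or `-log (1 - 2F)`.
As power series in `F` these have nonnegative coefficients, so `‖w‖` is at most the value at the
real point `‖F‖`. It stays below 1 when `‖F‖ < ρ`, where `ρ` is the real point at which the solution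
equals `φ_SG(1) = 2e / (1 + e)`; the threshold is `β = 5 / (3ρ)`. Below the threshold, the
subordinating map `l * z` with a suitable `l ≤ 1` yields a `p` that takes the value `φ_SG(1)` inside
the disc, which `φ_SG` does not (`not_subordinationImplies_of_solution`). -/

open Complex in
lemma norm_neg_log_one_sub_le {z : ℂ} {r : ℝ} (hz : ‖z‖ ≤ r) (hr : r < 1) :
    ‖-log (1 - z)‖ ≤ -Real.log (1 - r) := by
  have h1 := hasSum_taylorSeries_neg_log (z := z) (hz.trans_lt hr)
  have hr0 : 0 ≤ r := (norm_nonneg z).trans hz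
  have h2 := hasSum_taylorSeries_neg_log (z := (r : ℂ)) (by simpa [abs_of_nonneg hr0])
  have h3 : HasSum (fun n : ℕ => r ^ n / (n : ℝ)) (-Real.log (1 - r)) := by
    rw [← Complex.hasSum_ofReal]
    have : ((-Real.log (1 - r) : ℝ) : ℂ) = -log (1 - (r : ℂ)) := by
      rw [ofReal_neg, ofReal_log (by linarith)]; push_cast; rfl
    rw [this]
    exact_mod_cast h2
  refine h1.norm_le_of_bounded h3 fun n => ?_
  rw [norm_div, norm_pow, Complex.norm_natCast]
  gcongr

open Complex in
lemma norm_log_one_add_sub_log_one_sub_le {z : ℂ} {r : ℝ} (hz : ‖z‖ ≤ r) (hr : r < 1) :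
    ‖log (1 + z) - log (1 - z)‖ ≤ Real.log (1 + r) - Real.log (1 - r) := by
  have hr0 : 0 ≤ r := (norm_nonneg z).trans hz
  -- The coefficients are 0 for even `n` and `2 / n` for odd `n`; the constant term is `0 / 0 = 0`.
  have key : ∀ {u : ℂ}, ‖u‖ < 1 →
      HasSum (fun n : ℕ => (((1 - (-1) ^ n) / n : ℝ) : ℂ) * u ^ n) (log (1 + u) - log (1 - u)) := by
    intro u hu
    rw [sub_eq_add_neg]
    refine ((hasSum_taylorSeries_log hu).add (hasSum_taylorSeries_neg_log hu)).congr_fun ?_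
    intro n
    push_cast
    ring
  have h3 : HasSum (fun n : ℕ => (1 - (-1) ^ n) / (n : ℝ) * r ^ n)
      (Real.log (1 + r) - Real.log (1 - r)) := by
    rw [← Complex.hasSum_ofReal]
    have : ((Real.log (1 + r) - Real.log (1 - r) : ℝ) : ℂ)
        = log (1 + (r : ℂ)) - log (1 - (r : ℂ)) := by
      rw [ofReal_sub, ofReal_log (by linarith), ofReal_log (by linarith)]; push_cast; rfl
    rw [this]
    exact_mod_cast key (u := (r : ℂ)) (by simpa [abs_of_nonneg hr0])
  refine (key (hz.trans_lt hr)).norm_le_of_bounded h3 fun n => ?_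
  have hc : 0 ≤ (1 - (-1) ^ n) / (n : ℝ) := by
    rcases neg_one_pow_eq_or ℝ n with h | h <;> rw [h] <;> norm_num; positivity
  rw [norm_mul, norm_pow, Complex.norm_real, Real.norm_of_nonneg hc]
  gcongr

/-! ### Reduction to a differential equation on the disc -/

lemma zero_mem_unitDisk : (0 : ℂ) ∈ unitDisk := Metric.mem_ball_self one_pos

lemma mem_unitDisk {z : ℂ} : z ∈ unitDisk ↔ ‖z‖ < 1 := mem_ball_zero_iff

lemma isOpen_unitDisk : IsOpen unitDisk := Metric.isOpen_ball

lemma isPreconnected_unitDisk : IsPreconnected unitDisk :=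
  (convex_ball (0 : ℂ) 1).isPreconnected

lemma DifferentiableOn.exists_primitive_unitDisk {g : ℂ → ℂ} (hg : DifferentiableOn ℂ g unitDisk) :
    ∃ F : ℂ → ℂ, F 0 = 0 ∧ ∀ z ∈ unitDisk, HasDerivAt F (g z) z := by
  obtain ⟨F, hF⟩ := hg.isExactOn_ball.with_val_at 0 0
  exact ⟨F, hF⟩

/-- Integrating the bound along the radius from 0 to `z` gives `c * (4‖z‖ + ‖z‖ ^ 2)`, which is less
than `5 * c`. -/
lemma norm_primitive_lt {F g : ℂ → ℂ} {c : ℝ} (hc : 0 < c) (h0 : F 0 = 0)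
    (hF : ∀ z ∈ unitDisk, HasDerivAt F (g z) z)
    (hg : ∀ z ∈ unitDisk, ‖g z‖ ≤ c * (4 + 2 * ‖z‖)) {z : ℂ} (hz : z ∈ unitDisk) :
    ‖F z‖ < 5 * c := by
  have hz1 : ‖z‖ < 1 := mem_unitDisk.1 hz
  have hmem : ∀ t ∈ Set.Icc (0 : ℝ) 1, (t : ℂ) * z ∈ unitDisk := by
    intro t ht
    rw [mem_unitDisk, norm_mul, Complex.norm_real, Real.norm_of_nonneg ht.1]
    nlinarith [ht.1, ht.2, norm_nonneg z]
  have hd : ∀ t ∈ Set.Icc (0 : ℝ) 1,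
      HasDerivAt (fun t : ℝ => F (t * z)) (g (t * z) * z) t := by
    intro t ht
    have h1 : HasDerivAt (fun t : ℝ => (t : ℂ) * z) z t := by
      simpa using (Complex.ofRealCLM.hasDerivAt (x := t)).mul_const z
    exact (hF _ (hmem t ht)).comp t h1
  have hB : ∀ t : ℝ, HasDerivAt (fun t : ℝ => c * (4 * t * ‖z‖ + t ^ 2 * ‖z‖ ^ 2))
      (c * (4 + 2 * (t * ‖z‖)) * ‖z‖) t := by
    intro t
    have := ((((hasDerivAt_id t).const_mul 4).mul_const ‖z‖).add
      (((hasDerivAt_id t).pow 2).mul_const (‖z‖ ^ 2))).const_mul c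
    convert! this using 1
    simp; ring
  have := image_norm_le_of_norm_deriv_right_le_deriv_boundary
    (f := fun t : ℝ => F (t * z)) (f' := fun t => g (t * z) * z) (a := 0) (b := 1)
    (fun t ht => (hd t ht).continuousAt.continuousWithinAt)
    (fun t ht => (hd t ⟨ht.1, ht.2.le⟩).hasDerivWithinAt) (by simp [h0]) hB
    (fun t ht => by
      have h := hg _ (hmem t ⟨ht.1, ht.2.le⟩)
      rw [norm_mul, Complex.norm_real, Real.norm_of_nonneg ht.1] at h
      rw [norm_mul]
      gcongr) (Set.right_mem_Icc.2 zero_le_one)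
  simp only [Complex.ofReal_one, one_mul, mul_one, one_pow] at this
  refine this.trans_lt ?_
  nlinarith [norm_nonneg z, mul_pos hc (sub_pos.2 hz1)]

/-- A function satisfying the differential subordination solves `p' = F' p ^ j` for some analytic
`F` of controlled size. -/
lemma exists_primitive_of_subordinate {j : ℕ} {β : ℝ} (hβ : 0 < β) {p : ℂ → ℂ}
    (hp : AnalyticOnNhd ℂ p unitDisk) (hp0 : p 0 = 1) (h : Subordinate (diffExpr j β p) phiC) :
    ∃ F g : ℂ → ℂ, F 0 = 0 ∧ (∀ z ∈ unitDisk, ‖F z‖ < 5 / (3 * β)) ∧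
      ∀ z ∈ unitDisk, HasDerivAt F (g z) z ∧ HasDerivAt p (g z * p z ^ j) z := by
  obtain ⟨w, hw, hw0, hw1, hpw⟩ := h
  have hβ' : (β : ℂ) ≠ 0 := by exact_mod_cast hβ.ne'
  set k := dslope w 0 with hk
  have hkd : DifferentiableOn ℂ k unitDisk :=
    (Complex.differentiableOn_dslope (isOpen_unitDisk.mem_nhds zero_mem_unitDisk)).2
      hw.differentiableOn
  have hk1 : ∀ z ∈ unitDisk, ‖k z‖ ≤ 1 := fun z hz => by
    have := Complex.norm_dslope_le_div_of_mapsTo_ball (R₁ := 1) (R₂ := 1) (c := 0) (f := w)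
      hw.differentiableOn (fun z hz => by simpa [hw0] using (hw1 z hz).le) hz
    simpa using this
  have hwk : ∀ z, w z = z * k z := fun z => by
    simpa [hw0] using (sub_smul_dslope w 0 z).symm
  -- This is `(φ_c(w z) - 1) / (β z)` with the factor `z` cancelled.
  set g : ℂ → ℂ := fun z => (1 / (3 * β) : ℝ) * (4 * k z + 2 * (z * k z ^ 2)) with hgdef
  have hgd : DifferentiableOn ℂ g unitDisk := by fun_prop
  obtain ⟨F, hF0, hF⟩ := hgd.exists_primitive_unitDisk
  have hg : ∀ z ∈ unitDisk, ‖g z‖ ≤ 1 / (3 * β) * (4 + 2 * ‖z‖) := by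
    intro z hz
    rw [hgdef, norm_mul, Complex.norm_real, Real.norm_of_nonneg (by positivity)]
    gcongr
    refine (norm_add_le _ _).trans ?_
    simp only [norm_mul, norm_pow, Complex.norm_ofNat]
    have h1 := hk1 z hz
    have h2 : ‖k z‖ ^ 2 ≤ 1 := pow_le_one₀ (norm_nonneg _) h1
    nlinarith [norm_nonneg z]
  have hdp : AnalyticOnNhd ℂ (deriv p) unitDisk := hp.deriv
  have hgp : AnalyticOnNhd ℂ (fun z => g z * p z ^ j) unitDisk :=
    (hgd.analyticOnNhd isOpen_unitDisk).mul (hp.pow j)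
  -- The quotient can be cleared only where `p` is nonzero and `z ≠ 0`. This holds on a punctured
  -- neighbourhood of 0, and the identity theorem carries the equation to the whole disc, past
  -- possible zeros of `p`.
  have heq : Set.EqOn (deriv p) (fun z => g z * p z ^ j) unitDisk := by
    refine hdp.eqOn_of_preconnected_of_frequently_eq hgp isPreconnected_unitDisk
      zero_mem_unitDisk (Filter.Eventually.frequently ?_)
    have hne : ∀ᶠ z in nhds (0 : ℂ), p z ≠ 0 :=
      (hp 0 zero_mem_unitDisk).continuousAt.eventually_ne (by simp [hp0])
    filter_upwards [hne.filter_mono nhdsWithin_le_nhds, self_mem_nhdsWithin,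
      mem_nhdsWithin_of_mem_nhds (isOpen_unitDisk.mem_nhds zero_mem_unitDisk)] with z h1 h2 h3
    have h2' : z ≠ 0 := h2
    have h4 := hpw z h3
    rw [diffExpr, phiC, hwk] at h4
    have h5 : (β : ℂ) * (z * deriv p z / p z ^ j) = 4 * (z * k z) / 3 + 2 * (z * k z) ^ 2 / 3 := by
      linear_combination h4
    have h6 : p z ^ j ≠ 0 := pow_ne_zero _ h1
    have h7 : deriv p z = p z ^ j / (β * z) * ((β : ℂ) * (z * deriv p z / p z ^ j)) := by
      field_simp
    rw [h7, h5, hgdef]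
    push_cast
    field_simp
  refine ⟨F, g, hF0, fun z hz => ?_, fun z hz => ⟨hF z hz, ?_⟩⟩
  · have := norm_primitive_lt (by positivity) hF0 hF hg hz
    convert this using 1
    field_simp
  · have := (hp z hz).differentiableAt.hasDerivAt
    rwa [heq hz] at this

/-! ### Solving `p' = F' p ^ j` for `j = 0, 1, 2` -/

lemma eq_of_hasDerivAt_zero_unitDisk {f : ℂ → ℂ} (hf : ∀ z ∈ unitDisk, HasDerivAt f 0 z) {z : ℂ}
    (hz : z ∈ unitDisk) : f z = f 0 :=
  isOpen_unitDisk.is_const_of_deriv_eq_zero isPreconnected_unitDisk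
    (fun x hx => (hf x hx).differentiableAt.differentiableWithinAt)
    (fun x hx => (hf x hx).deriv) hz zero_mem_unitDisk

lemma eq_one_add_of_hasDerivAt {F g p : ℂ → ℂ} (hF0 : F 0 = 0) (hp0 : p 0 = 1)
    (h : ∀ z ∈ unitDisk, HasDerivAt F (g z) z ∧ HasDerivAt p (g z * p z ^ 0) z) {z : ℂ}
    (hz : z ∈ unitDisk) : p z = 1 + F z := by
  have := eq_of_hasDerivAt_zero_unitDisk (f := fun z => p z - F z)
    (fun z hz => by
      convert! (h z hz).2.sub (h z hz).1 using 1
      ring) hz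
  simp only [hp0, hF0] at this
  linear_combination this

lemma eq_exp_of_hasDerivAt {F g p : ℂ → ℂ} (hF0 : F 0 = 0) (hp0 : p 0 = 1)
    (h : ∀ z ∈ unitDisk, HasDerivAt F (g z) z ∧ HasDerivAt p (g z * p z ^ 1) z) {z : ℂ}
    (hz : z ∈ unitDisk) : p z = Complex.exp (F z) := by
  have := eq_of_hasDerivAt_zero_unitDisk (f := fun z => p z * Complex.exp (-F z))
    (fun z hz => by
      convert! (h z hz).2.mul (h z hz).1.neg.cexp using 1
      simp only [Pi.neg_apply]
      ring) hz
  simp only [hp0, hF0, neg_zero, Complex.exp_zero, mul_one] at this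
  rw [Complex.exp_neg] at this
  field_simp [Complex.exp_ne_zero] at this
  exact this

/-- Dividing by `p ^ 2` would require `p` to have no zeros. Instead `y = p (1 - F) - 1` solves the
linear equation `y' = p g y` with `y 0 = 0`, and the integrating factor `exp (-Q)` forces `y = 0`.
-/
lemma mul_one_sub_eq_one_of_hasDerivAt {F g p : ℂ → ℂ} (hF0 : F 0 = 0) (hp0 : p 0 = 1)
    (hp : AnalyticOnNhd ℂ p unitDisk) (hg : AnalyticOnNhd ℂ g unitDisk)
    (h : ∀ z ∈ unitDisk, HasDerivAt F (g z) z ∧ HasDerivAt p (g z * p z ^ 2) z) {z : ℂ}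
    (hz : z ∈ unitDisk) : p z * (1 - F z) = 1 := by
  obtain ⟨Q, hQ0, hQ⟩ := (hp.mul hg).differentiableOn.exists_primitive_unitDisk
  have := eq_of_hasDerivAt_zero_unitDisk
    (f := fun z => (p z * (1 - F z) - 1) * Complex.exp (-Q z))
    (fun z hz => by
      convert! (((h z hz).2.mul ((h z hz).1.const_sub 1)).sub_const 1).mul
        (hQ z hz).neg.cexp using 1
      simp only [Pi.neg_apply, Pi.mul_apply]
      ring) hz
  simp only [hp0, hF0, sub_zero, mul_one, sub_self, zero_mul, mul_eq_zero, Complex.exp_ne_zero,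
    or_false] at this
  linear_combination this

/-! ### The three implications -/

lemma subordinate_phiSG_of_exp {p w : ℂ → ℂ} (hw : DifferentiableOn ℂ w unitDisk) (hw0 : w 0 = 0)
    (hw1 : ∀ z ∈ unitDisk, ‖w z‖ < 1)
    (h : ∀ z ∈ unitDisk, p z ≠ 0 ∧ p z * Complex.exp (-w z) = 2 - p z) : Subordinate p phiSG := by
  refine ⟨w, hw.analyticOnNhd isOpen_unitDisk, hw0, hw1, fun z hz => ?_⟩
  obtain ⟨h1, h2⟩ := h z hz
  have h3 : p z * (1 + Complex.exp (-w z)) = 2 := by linear_combination h2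
  rw [phiSG, eq_div_iff (right_ne_zero_of_mul (h3 ▸ two_ne_zero)), h3]

lemma one_sub_mem_slitPlane {u : ℂ} (hu : ‖u‖ < 1) : 1 - u ∈ Complex.slitPlane := by
  simpa [sub_eq_add_neg] using Complex.mem_slitPlane_of_norm_lt_one (z := -u) (by simpa)

lemma one_lt_exp_one : 1 < Real.exp 1 := Real.one_lt_exp_iff.2 one_pos

lemma div_le_of_div_le {β ρ : ℝ} (hρ : 0 < ρ) (h : 5 / (3 * ρ) ≤ β) :
    0 < β ∧ 5 / (3 * β) ≤ ρ := by
  have hβ : 0 < β := lt_of_lt_of_le (by positivity) h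
  refine ⟨hβ, ?_⟩
  rw [div_le_iff₀ (by positivity)] at h ⊢
  linarith

theorem subordinationImplies_zero {β : ℝ}
    (h : 5 / (3 * ((Real.exp 1 - 1) / (Real.exp 1 + 1))) ≤ β) : SubordinationImplies 0 β := by
  intro p hp hp0 hsub
  have he := one_lt_exp_one
  obtain ⟨hβ, hρ⟩ := div_le_of_div_le (by apply div_pos <;> linarith) h
  obtain ⟨F, g, hF0, hFn, hFd⟩ := exists_primitive_of_subordinate hβ hp hp0 hsub
  have hFdiff : DifferentiableOn ℂ F unitDisk :=
    fun z hz => (hFd z hz).1.differentiableAt.differentiableWithinAt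
  have hlt : ∀ z ∈ unitDisk, ‖F z‖ < (Real.exp 1 - 1) / (Real.exp 1 + 1) :=
    fun z hz => (hFn z hz).trans_le hρ
  have hlt1 : ∀ z ∈ unitDisk, ‖F z‖ < 1 := fun z hz =>
    (hlt z hz).trans (by rw [div_lt_one (by linarith)]; linarith)
  refine subordinate_phiSG_of_exp
    (w := fun z => Complex.log (1 + F z) - Complex.log (1 - F z)) ?_ (by simp [hF0]) ?_ ?_
  · exact ((hFdiff.const_add 1).clog fun z hz =>
      Complex.mem_slitPlane_of_norm_lt_one (hlt1 z hz)).sub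
      ((hFdiff.const_sub 1).clog fun z hz => one_sub_mem_slitPlane (hlt1 z hz))
  · intro z hz
    refine (norm_log_one_add_sub_log_one_sub_le le_rfl (hlt1 z hz)).trans_lt ?_
    have h1 := hlt1 z hz
    have h2 := hlt z hz
    have h0 := norm_nonneg (F z)
    rw [← Real.log_div (by linarith) (by linarith), Real.log_lt_iff_lt_exp
      (div_pos (by linarith) (by linarith)), div_lt_iff₀ (by linarith)]
    rw [lt_div_iff₀ (by linarith)] at h2
    linarith
  · intro z hz
    have h1 := Complex.slitPlane_ne_zero (Complex.mem_slitPlane_of_norm_lt_one (hlt1 z hz))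
    have h2 := Complex.slitPlane_ne_zero (one_sub_mem_slitPlane (hlt1 z hz))
    rw [eq_one_add_of_hasDerivAt hF0 hp0 hFd hz]
    refine ⟨h1, ?_⟩
    rw [neg_sub, Complex.exp_sub, Complex.exp_log h1, Complex.exp_log h2]
    field_simp
    ring

theorem subordinationImplies_one {β : ℝ}
    (h : 5 / (3 * (1 + Real.log 2 - Real.log (1 + Real.exp 1))) ≤ β) :
    SubordinationImplies 1 β := by
  intro p hp hp0 hsub
  have he := one_lt_exp_one
  have hexp : Real.exp (1 + Real.log 2 - Real.log (1 + Real.exp 1)) =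
      2 * Real.exp 1 / (1 + Real.exp 1) := by
    rw [Real.exp_sub, Real.exp_add, Real.exp_log two_pos, Real.exp_log (by linarith), mul_comm]
  have hpos : 0 < 1 + Real.log 2 - Real.log (1 + Real.exp 1) := by
    rw [← Real.one_lt_exp_iff, hexp, lt_div_iff₀ (by linarith)]
    linarith
  obtain ⟨hβ, hρ⟩ := div_le_of_div_le hpos h
  obtain ⟨F, g, hF0, hFn, hFd⟩ := exists_primitive_of_subordinate hβ hp hp0 hsub
  have hFdiff : DifferentiableOn ℂ F unitDisk :=
    fun z hz => (hFd z hz).1.differentiableAt.differentiableWithinAt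
  have hlt : ∀ z ∈ unitDisk, Real.exp ‖F z‖ < 2 * Real.exp 1 / (1 + Real.exp 1) :=
    fun z hz => hexp ▸ Real.exp_lt_exp.2 ((hFn z hz).trans_le hρ)
  have hlt2 : ∀ z ∈ unitDisk, Real.exp ‖F z‖ < 2 := fun z hz =>
    (hlt z hz).trans (by rw [div_lt_iff₀ (by linarith)]; linarith)
  -- The partial sum of length 1 is the constant term 1.
  have hle : ∀ z, ‖Complex.exp (F z) - 1‖ ≤ Real.exp ‖F z‖ - 1 := fun z => by
    simpa using Complex.norm_exp_sub_sum_le_exp_norm_sub_sum (F z) 1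
  have hlt1 : ∀ z ∈ unitDisk, ‖Complex.exp (F z) - 1‖ < 1 := fun z hz =>
    (hle z).trans_lt (by linarith [hlt2 z hz])
  refine subordinate_phiSG_of_exp
    (w := fun z => F z + -Complex.log (1 - (Complex.exp (F z) - 1))) ?_ (by simp [hF0]) ?_ ?_
  · exact hFdiff.add (((hFdiff.cexp.sub_const 1).const_sub 1).clog
      fun z hz => one_sub_mem_slitPlane (hlt1 z hz)).neg
  · intro z hz
    have h2 := hlt2 z hz
    have h3 := hlt z hz
    refine (norm_add_le_of_le le_rfl (norm_neg_log_one_sub_le (hle z) (by linarith))).trans_lt ?_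
    -- After exponentiation the claim is `x / (2 - x) < e` for `x = exp ‖F z‖`, which is `x < 2e /
    -- (1 + e)`.
    rw [← sub_eq_add_neg, ← Real.exp_lt_exp, Real.exp_sub, Real.exp_log (by linarith),
      div_lt_iff₀ (by linarith)]
    rw [lt_div_iff₀ (by linarith)] at h3
    linarith
  · intro z hz
    have h2 := Complex.slitPlane_ne_zero (one_sub_mem_slitPlane (hlt1 z hz))
    rw [eq_exp_of_hasDerivAt hF0 hp0 hFd hz]
    refine ⟨Complex.exp_ne_zero _, ?_⟩
    rw [neg_add, neg_neg, Complex.exp_add, Complex.exp_log h2, Complex.exp_neg]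
    field_simp [Complex.exp_ne_zero]
    ring

theorem subordinationImplies_two {β : ℝ}
    (h : 5 / (3 * ((Real.exp 1 - 1) / (2 * Real.exp 1))) ≤ β) : SubordinationImplies 2 β := by
  intro p hp hp0 hsub
  have he := one_lt_exp_one
  obtain ⟨hβ, hρ⟩ := div_le_of_div_le (by apply div_pos <;> linarith) h
  obtain ⟨F, g, hF0, hFn, hFd⟩ := exists_primitive_of_subordinate hβ hp hp0 hsub
  have hFdiff : DifferentiableOn ℂ F unitDisk :=
    fun z hz => (hFd z hz).1.differentiableAt.differentiableWithinAt
  have hg : AnalyticOnNhd ℂ g unitDisk :=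
    (hFdiff.analyticOnNhd isOpen_unitDisk).deriv.congr isOpen_unitDisk
      fun z hz => (hFd z hz).1.deriv
  have hlt : ∀ z ∈ unitDisk, ‖2 * F z‖ < (Real.exp 1 - 1) / Real.exp 1 := fun z hz => by
    have h1 := (hFn z hz).trans_le hρ
    rw [norm_mul, Complex.norm_ofNat]
    rw [lt_div_iff₀ (by linarith)] at h1 ⊢
    linarith
  have hlt1 : ∀ z ∈ unitDisk, ‖2 * F z‖ < 1 := fun z hz =>
    (hlt z hz).trans (by rw [div_lt_one (by linarith)]; linarith)
  refine subordinate_phiSG_of_exp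
    (w := fun z => -Complex.log (1 - 2 * F z)) ?_ (by simp [hF0]) ?_ ?_
  · exact (((hFdiff.const_mul 2).const_sub 1).clog
      fun z hz => one_sub_mem_slitPlane (hlt1 z hz)).neg
  · intro z hz
    refine (norm_neg_log_one_sub_le le_rfl (hlt1 z hz)).trans_lt ?_
    have h1 := hlt1 z hz
    have h2 := hlt z hz
    rw [neg_lt, Real.lt_log_iff_exp_lt (by linarith), Real.exp_neg, inv_lt_iff_one_lt_mul₀
      (by linarith)]
    rw [lt_div_iff₀ (by linarith)] at h2
    linarith
  · intro z hz
    have h2 := Complex.slitPlane_ne_zero (one_sub_mem_slitPlane (hlt1 z hz))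
    have h3 := mul_one_sub_eq_one_of_hasDerivAt hF0 hp0 hp hg hFd hz
    refine ⟨left_ne_zero_of_mul (h3 ▸ one_ne_zero), ?_⟩
    rw [neg_neg, Complex.exp_log h2]
    linear_combination 2 * h3

/-! ### Sharpness -/

/-- The value is `φ_SG(1)`, and `φ_SG(w) = φ_SG(1)` forces `exp (1 - w) = 1`, so `w` has real part 1
and lies outside the open disc. -/
lemma not_subordinate_phiSG_of_eq {p : ℂ → ℂ} {z : ℂ} (hz : z ∈ unitDisk)
    (h : p z = 2 * Complex.exp 1 / (1 + Complex.exp 1)) : ¬ Subordinate p phiSG := by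
  rintro ⟨w, -, -, hw1, hpw⟩
  have hne : 1 + Complex.exp 1 ≠ 0 := by
    have : ((1 + Real.exp 1 : ℝ) : ℂ) ≠ 0 := Complex.ofReal_ne_zero.2 (by positivity)
    push_cast at this
    exact this
  have h1 := hpw z hz
  rw [h, phiSG] at h1
  have h2 : 1 + Complex.exp (-w z) ≠ 0 := by
    intro h0
    rw [h0, div_zero, div_eq_zero_iff] at h1
    simp [hne, Complex.exp_ne_zero] at h1
  rw [div_eq_div_iff hne h2] at h1
  have h3 : Complex.exp 1 * Complex.exp (-w z) = 1 := by linear_combination h1 / 2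
  rw [← Complex.exp_add] at h3
  have h4 : Real.exp (1 + -w z).re = Real.exp 0 := by
    rw [← Complex.norm_exp, h3, norm_one, Real.exp_zero]
  have h5 := Real.exp_injective h4
  simp only [Complex.add_re, Complex.one_re, Complex.neg_re] at h5
  linarith [hw1 z hz, Complex.re_le_norm (w z)]

/-- The potential `M(z) = (4 l z + (l z)²) / (3 β)` has `β z M'(z) = φ_c(l z) - 1`. A solution
`P ∘ M` of `p' = M' p ^ j` that attains the boundary value `φ_SG(1)` shows that the implication
fails. -/
lemma not_subordinationImplies_of_solution {j : ℕ} {β l ρ : ℝ} (hβ : 0 < β) (hl0 : 0 ≤ l)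
    (hl1 : l ≤ 1) (hρ : 0 < ρ) (hρl : ρ < (4 * l + l ^ 2) / (3 * β)) (P : ℂ → ℂ) (hP0 : P 0 = 1)
    (hPρ : P ρ = 2 * Complex.exp 1 / (1 + Complex.exp 1))
    (hP : ∀ u : ℂ, ‖u‖ < (4 * l + l ^ 2) / (3 * β) → P u ^ j ≠ 0 ∧ HasDerivAt P (P u ^ j) u) :
    ¬ SubordinationImplies j β := by
  intro h
  have hβ' : (β : ℂ) ≠ 0 := by exact_mod_cast hβ.ne'
  have hl : 0 < l := by
    rcases hl0.eq_or_lt with rfl | h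
    · simp at hρl; linarith
    · exact h
  set M : ℂ → ℂ := fun z => (4 * (l * z) + (l * z) ^ 2) / (3 * β) with hM
  have hMd : ∀ z, HasDerivAt M ((4 * l + 2 * l ^ 2 * z) / (3 * β)) z := by
    intro z
    have h1 : HasDerivAt (fun z : ℂ => (l : ℂ) * z) l z := by
      simpa using (hasDerivAt_id z).const_mul (l : ℂ)
    convert! ((h1.const_mul 4).add (h1.pow 2)).div_const (3 * (β : ℂ)) using 1
    push_cast
    ring
  have hMn : ∀ z ∈ unitDisk, ‖M z‖ < (4 * l + l ^ 2) / (3 * β) := by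
    intro z hz
    have hz1 := mem_unitDisk.1 hz
    rw [hM]
    simp only [norm_div, norm_mul, Complex.norm_ofNat, Complex.norm_real,
      Real.norm_of_nonneg hβ.le]
    gcongr
    refine (norm_add_le _ _).trans_lt ?_
    simp only [norm_mul, norm_pow, Complex.norm_ofNat, Complex.norm_real,
      Real.norm_of_nonneg hl.le]
    have : l * ‖z‖ < l := by nlinarith
    have h0 : 0 ≤ l * ‖z‖ := by positivity
    nlinarith
  have hpd : ∀ z ∈ unitDisk, HasDerivAt (fun z => P (M z))
      (P (M z) ^ j * ((4 * l + 2 * l ^ 2 * z) / (3 * β))) z :=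
    fun z hz => (hP _ (hMn z hz)).2.comp z (hMd z)
  -- On the real segment `M` increases from 0 past `ρ`, so it takes the value `ρ` at an interior
  -- point.
  obtain ⟨r, hr, hMr⟩ : ∃ r ∈ Set.Ioo (0 : ℝ) 1, (4 * (l * r) + (l * r) ^ 2) / (3 * β) = ρ := by
    apply intermediate_value_Ioo zero_le_one
      (f := fun r : ℝ => (4 * (l * r) + (l * r) ^ 2) / (3 * β)) (by fun_prop)
    simpa using ⟨hρ, hρl⟩
  refine not_subordinate_phiSG_of_eq (p := fun z => P (M z)) (z := (r : ℂ)) ?_ ?_ (h _ ?_ ?_ ?_)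
  · rw [mem_unitDisk, Complex.norm_real, Real.norm_of_nonneg hr.1.le]
    exact hr.2
  · have : M r = (ρ : ℂ) := by
      rw [← hMr, hM]; push_cast; rfl
    rw [this, hPρ]
  · exact DifferentiableOn.analyticOnNhd
      (fun z hz => (hpd z hz).differentiableAt.differentiableWithinAt) isOpen_unitDisk
  · simp [hM, hP0]
  · refine ⟨fun z => l * z, ?_, by simp, fun z hz => ?_, fun z hz => ?_⟩
    · exact DifferentiableOn.analyticOnNhd (by fun_prop) isOpen_unitDisk
    · rw [norm_mul, Complex.norm_real, Real.norm_of_nonneg hl.le]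
      have := mem_unitDisk.1 hz
      nlinarith [norm_nonneg z]
    · have h1 := (hP _ (hMn z hz)).1
      rw [diffExpr, phiC, (hpd z hz).deriv]
      field_simp
      ring

lemma lt_div_of_lt_div {β ρ : ℝ} (hβ : 0 < β) (hρ : 0 < ρ) (h : β < 5 / (3 * ρ)) :
    ρ < 5 / (3 * β) := by
  rw [lt_div_iff₀ (by positivity)] at h ⊢
  linarith

theorem not_subordinationImplies_zero {β : ℝ} (hβ : 0 < β)
    (h : β < 5 / (3 * ((Real.exp 1 - 1) / (Real.exp 1 + 1)))) : ¬ SubordinationImplies 0 β := by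
  have he := one_lt_exp_one
  have hρ : 0 < (Real.exp 1 - 1) / (Real.exp 1 + 1) := by apply div_pos <;> linarith
  refine not_subordinationImplies_of_solution hβ zero_le_one le_rfl hρ
    ((lt_div_of_lt_div hβ hρ h).trans_eq (by norm_num)) (fun u => 1 + u) (by simp) ?_
    (fun u _ => ⟨by simp, by simpa using (hasDerivAt_id u).const_add 1⟩)
  have hne : Real.exp 1 + 1 ≠ 0 := by linarith
  have : 1 + (Real.exp 1 - 1) / (Real.exp 1 + 1) = 2 * Real.exp 1 / (1 + Real.exp 1) := by
    rw [add_comm 1 (Real.exp 1)]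
    field_simp
    ring
  have hC := congrArg Complex.ofReal this
  push_cast at hC ⊢
  exact hC

theorem not_subordinationImplies_one {β : ℝ} (hβ : 0 < β)
    (h : β < 5 / (3 * (1 + Real.log 2 - Real.log (1 + Real.exp 1)))) :
    ¬ SubordinationImplies 1 β := by
  have he := one_lt_exp_one
  have hexp : Real.exp (1 + Real.log 2 - Real.log (1 + Real.exp 1)) =
      2 * Real.exp 1 / (1 + Real.exp 1) := by
    rw [Real.exp_sub, Real.exp_add, Real.exp_log two_pos, Real.exp_log (by linarith), mul_comm]
  have hρ : 0 < 1 + Real.log 2 - Real.log (1 + Real.exp 1) := by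
    rw [← Real.one_lt_exp_iff, hexp, lt_div_iff₀ (by linarith)]
    linarith
  refine not_subordinationImplies_of_solution hβ zero_le_one le_rfl hρ
    ((lt_div_of_lt_div hβ hρ h).trans_eq (by norm_num)) Complex.exp Complex.exp_zero ?_
    (fun u _ => ⟨by simp [Complex.exp_ne_zero], by simpa using Complex.hasDerivAt_exp u⟩)
  rw [← Complex.ofReal_exp, hexp]
  push_cast
  rfl

theorem not_subordinationImplies_two {β : ℝ} (hβ : 0 < β)
    (h : β < 5 / (3 * ((Real.exp 1 - 1) / (2 * Real.exp 1)))) : ¬ SubordinationImplies 2 β := by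
  have he := one_lt_exp_one
  have hρ : 0 < (Real.exp 1 - 1) / (2 * Real.exp 1) := by apply div_pos <;> linarith
  have hρ2 : (Real.exp 1 - 1) / (2 * Real.exp 1) < 1 / 2 := by
    rw [div_lt_iff₀ (by linarith)]; linarith
  obtain ⟨l, hl0, hl1, hρl, hl⟩ : ∃ l : ℝ, 0 ≤ l ∧ l ≤ 1 ∧
      (Real.exp 1 - 1) / (2 * Real.exp 1) < (4 * l + l ^ 2) / (3 * β) ∧
      (4 * l + l ^ 2) / (3 * β) ≤ 1 := by
    -- The solution `1 / (1 - u)` has a pole at 1, so the range of the potential must stay in the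
    -- unit disc. For `β < 5 / 3` the choice `l = 1` breaks this; `l = 3β / 5` gives the radius `4 /
    -- 5 + 3β / 25`, which is at most 1 and still exceeds `1 / 2 > ρ`.
    rcases le_total (5 / 3) β with hb | hb
    · refine ⟨1, zero_le_one, le_rfl, (lt_div_of_lt_div hβ hρ h).trans_eq (by norm_num), ?_⟩
      rw [div_le_one (by positivity)]
      linarith
    · refine ⟨3 * β / 5, by positivity, by linarith, hρ2.trans ?_, ?_⟩
      · rw [lt_div_iff₀ (by positivity)]
        nlinarith
      · rw [div_le_one (by positivity)]
        nlinarith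
  refine not_subordinationImplies_of_solution hβ hl0 hl1 hρ hρl (fun u => (1 - u)⁻¹) (by simp) ?_
    fun u hu => ?_
  · have hne : 1 + Real.exp 1 ≠ 0 := by linarith
    have : (1 - (Real.exp 1 - 1) / (2 * Real.exp 1))⁻¹ = 2 * Real.exp 1 / (1 + Real.exp 1) := by
      rw [inv_eq_iff_eq_inv, inv_div]
      field_simp
      ring
    have hC := congrArg Complex.ofReal this
    push_cast at hC ⊢
    exact hC
  · have h1 := Complex.slitPlane_ne_zero (one_sub_mem_slitPlane (hu.trans_le hl))
    refine ⟨by positivity, ?_⟩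
    convert! ((hasDerivAt_id u).const_sub 1).inv h1 using 1
    simp

/-- The three implications, each with its threshold for `β`, and the sharpness of each threshold:
for every positive `β` below it the implication fails. -/
theorem theorem2p13 :
    ((∀ β : ℝ, 5 * (Real.exp 1 + 1) / (3 * (Real.exp 1 - 1)) ≤ β → SubordinationImplies 0 β) ∧
      (∀ β : ℝ, 0 < β → β < 5 * (Real.exp 1 + 1) / (3 * (Real.exp 1 - 1)) →
        ¬ SubordinationImplies 0 β)) ∧
    ((∀ β : ℝ, 5 / (3 * (1 + Real.log 2 - Real.log (1 + Real.exp 1))) ≤ β →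
        SubordinationImplies 1 β) ∧
      (∀ β : ℝ, 0 < β → β < 5 / (3 * (1 + Real.log 2 - Real.log (1 + Real.exp 1))) →
        ¬ SubordinationImplies 1 β)) ∧
    ((∀ β : ℝ, 10 * Real.exp 1 / (3 * (Real.exp 1 - 1)) ≤ β → SubordinationImplies 2 β) ∧
      (∀ β : ℝ, 0 < β → β < 10 * Real.exp 1 / (3 * (Real.exp 1 - 1)) →
        ¬ SubordinationImplies 2 β)) := by
  have he := one_lt_exp_one
  have ha : 5 * (Real.exp 1 + 1) / (3 * (Real.exp 1 - 1)) =
      5 / (3 * ((Real.exp 1 - 1) / (Real.exp 1 + 1))) := by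
    have h1 : Real.exp 1 - 1 ≠ 0 := by linarith
    have h2 : Real.exp 1 + 1 ≠ 0 := by linarith
    field_simp
  have hc : 10 * Real.exp 1 / (3 * (Real.exp 1 - 1)) =
      5 / (3 * ((Real.exp 1 - 1) / (2 * Real.exp 1))) := by
    have h1 : Real.exp 1 - 1 ≠ 0 := by linarith
    field_simp
    norm_num
  rw [ha, hc]
  exact ⟨⟨fun _ => subordinationImplies_zero, fun _ => not_subordinationImplies_zero⟩,
    ⟨fun _ => subordinationImplies_one, fun _ => not_subordinationImplies_one⟩,
    ⟨fun _ => subordinationImplies_two, fun _ => not_subordinationImplies_two⟩⟩
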